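/- All systems are finite-dimensional nonzero Hilbert spaces with a fixed orthonormal basis (the product basis for composite systems); $\mathcal{D}_A(\rho)=\sum_i |i\rangle\langle i|\rho|i\rangle\langle i|$ is the dephasing map of $A$ in this basis, $|A|$ is the dimension, and $\log$ is to base $2$. A channel is a completely positive trace-preserving linear map; $\mathrm{CPTP}(A_0\to A_1)$ is the set of channels from operators on $A_0$ to operators on $A_1$. A channel $\mathcal{E}\in\mathrm{CPTP}(A_0\to A_1)$ is classical, $\mathcal{E}\in\mathfrak{C}(A_0\to A_1)$, if $\mathcal{E}=\mathcal{D}_{A_1}\circ\mathcal{E}\circ\mathcal{D}_{A_0}$. A superchannel $\Theta$ from $A=(A_0,A_1)$ to $B=(B_0,B_1)$ is a linear map, from the space of linear maps between the operators on $A_0$ and those on $A_1$ to the corresponding space for $B$, such that for every $R=(R_0,R_1)$ the map $\mathbb{1}_R\otimes\Theta$ takes channels to channels. It is in $\mathrm{MISC}(A\to B)$ if it takes classical channels to classical channels. A static system $R_1$ is regarded as the pair (trivial system, $R_1$), so that states of $R_1$ are channels, and $\phi^+_{R_1}=\frac{1}{|R_1|}\sum_{i,j}|i\rangle\langle j|$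 is its maximally coherent state. For channels put $$D_{\max}(\mathcal{N}\|\mathcal{E})=\log\min\{t : t\mathcal{E}-\mathcal{N}\text{ is completely positive}\}$$ ($+\infty$ if there is no such $t$), and $$LR_{\mathfrak{C}}(\mathcal{N})=\min_{\mathcal{E}\in\mathfrak{C}(A_0\to A_1)}D_{\max}(\mathcal{N}\|\mathcal{E}),$$ $$C^0_{\mathrm{MISC}}(\mathcal{N})=\min\{\log|R_1| : \exists\,\Theta\in\mathrm{MISC}(R_1\to A),\ \Theta[\phi^+_{R_1}]=\mathcal{N}\}.$$ **Theorem.** For every $\mathcal{N}\in\mathrm{CPTP}(A_0\to A_1)$ the minimum defining $LR_{\mathfrak{C}}(\mathcal{N})$ is attained and finite, the minimum defining $C^0_{\mathrm{MISC}}(\mathcal{N}^{\otimes n})$ is attained for every $n$, and the exact asymptotic coherence cost of $\mathcal{N}$ under MISC exists and equals the log-robustness of dynamical coherence: $$C^{\mathrm{exact}}_{\mathrm{MISC}}(\mathcal{N}) := \lim_{n\to\infty}\frac1n\, C^0_{\mathrm{MISC}}(\mathcal{N}^{\otimes n}) = LR_{\mathfrak{C}}(\mathcal{N}).$$ -/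

import Mathlib

open scoped ComplexOrder

noncomputable section

namespace DynCoherence

/-- Linear maps `𝔏(A₀ → A₁)` from the operators on `A₀` to the operators on `A₁`. A quantum system
is a finite type, whose elements label the fixed (incoherent) orthonormal basis of its space. -/
abbrev LMap (A₀ A₁ : Type*) : Type _ := Matrix A₀ A₀ ℂ →ₗ[ℂ] Matrix A₁ A₁ ℂ

/-- The block `⟨r| X |s⟩` of an operator on `R ⊗ A`, as a linear function of `X`. -/
def block {R A : Type*} (r s : R) : Matrix (R × A) (R × A) ℂ →ₗ[ℂ] Matrix A A ℂ where
  toFun X := Matrix.of fun a b => X (r, a) (s, b)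
  map_add' _ _ := rfl
  map_smul' _ _ := rfl

/-- The ampliation `id_R ⊗ Φ`, which applies `Φ` to every block. -/
def ampliation {A₀ A₁ : Type*} (R : Type*) (Φ : LMap A₀ A₁) : LMap (R × A₀) (R × A₁) where
  toFun X := Matrix.of fun p q => Φ (block p.1 q.1 X) p.2 q.2
  map_add' X Y := by ext p q; simp
  map_smul' c X := by ext p q; simp

/-- Complete positivity. -/
def IsCP {A₀ A₁ : Type*} (Φ : LMap A₀ A₁) : Prop :=
  ∀ (k : ℕ) (X : Matrix (Fin k × A₀) (Fin k × A₀) ℂ),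
    X.PosSemidef → (ampliation (Fin k) Φ X).PosSemidef

/-- Quantum channels: completely positive trace-preserving maps. -/
structure IsChannel {A₀ A₁ : Type*} [Fintype A₀] [Fintype A₁] (Φ : LMap A₀ A₁) : Prop where
  cp : IsCP Φ
  tp : ∀ X : Matrix A₀ A₀ ℂ, (Φ X).trace = X.trace

/-- The dephasing channel of a system in its fixed basis: it keeps the diagonal entries and
replaces the other ones by zero. -/
def dephasing (A : Type*) [DecidableEq A] : LMap A A where
  toFun X := Matrix.diagonal X.diag
  map_add' X Y := by ext a b; by_cases h : a = b <;> simp [Matrix.diagonal, h]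
  map_smul' c X := by ext a b; by_cases h : a = b <;> simp [Matrix.diagonal, h]

/-- Classical channels: channels `E` with `E = 𝒟 ∘ E ∘ 𝒟`. -/
structure IsClassical {A₀ A₁ : Type*} [Fintype A₀] [Fintype A₁] [DecidableEq A₀] [DecidableEq A₁]
    (E : LMap A₀ A₁) : Prop where
  channel : IsChannel E
  dephased : E = dephasing A₁ ∘ₗ E ∘ₗ dephasing A₀

/-- The component `X ↦ ⟨k| M(|i⟩⟨j| ⊗ X) |l⟩` in `𝔏(A₀ → A₁)` of `M ∈ 𝔏(R₀A₀ → R₁A₁)`. In other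
words `M = ∑ E^{ijkl} ⊗ component i j k l M`, where `E^{ijkl}(ρ) = ⟨i|ρ|j⟩ |k⟩⟨l|` is the canonical
basis of `𝔏(R₀ → R₁)`. -/
def component {R₀ R₁ A₀ A₁ : Type*} [DecidableEq R₀] (i j : R₀) (k l : R₁)
    (M : LMap (R₀ × A₀) (R₁ × A₁)) : LMap A₀ A₁ where
  toFun X := block k l (M (Matrix.kronecker (Matrix.single i j 1) X))
  map_add' X Y := by simp [Matrix.kronecker, Matrix.kroneckerMap_add_right, mul_add]
  map_smul' c X := by
    have h : Matrix.kronecker (Matrix.single i j (1 : ℂ)) (c • X)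
        = c • Matrix.kronecker (Matrix.single i j (1 : ℂ)) X := Matrix.kronecker_smul c _ _
    rw [h]; simp

/-- The action of the supermap `𝟙_R ⊗ Θ` on `M ∈ 𝔏(R₀A₀ → R₁A₁)`: the map
`∑ E^{ijkl} ⊗ Θ[component i j k l M]`. -/
def idTensor {R₀ R₁ A₀ A₁ B₀ B₁ : Type*} [Fintype R₀] [DecidableEq R₀]
    (Θ : LMap A₀ A₁ →ₗ[ℂ] LMap B₀ B₁) (M : LMap (R₀ × A₀) (R₁ × A₁)) :
    LMap (R₀ × B₀) (R₁ × B₁) where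
  toFun Y := Matrix.of fun p q =>
    ∑ i : R₀, ∑ j : R₀, Θ (component i j p.1 q.1 M) (block i j Y) p.2 q.2
  map_add' X Y := by ext p q; simp [Finset.sum_add_distrib]
  map_smul' c X := by ext p q; simp [Finset.mul_sum]

/-- Superchannels: supermaps that take channels to channels, even when tensored with the identity
supermap of an arbitrary dynamical system `R = (R₀, R₁)`. -/
def IsSuperchannel {A₀ A₁ B₀ B₁ : Type*} [Fintype A₀] [Fintype A₁] [Fintype B₀] [Fintype B₁]
    (Θ : LMap A₀ A₁ →ₗ[ℂ] LMap B₀ B₁) : Prop :=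
  ∀ (r₀ r₁ : ℕ) (M : LMap (Fin r₀ × A₀) (Fin r₁ × A₁)),
    IsChannel M → IsChannel (idTensor Θ M)

/-- Maximally incoherent superchannels (MISC): superchannels that take classical channels to
classical channels. -/
structure IsMISC {A₀ A₁ B₀ B₁ : Type*} [Fintype A₀] [Fintype A₁] [Fintype B₀] [Fintype B₁]
    [DecidableEq A₀] [DecidableEq A₁] [DecidableEq B₀] [DecidableEq B₁]
    (Θ : LMap A₀ A₁ →ₗ[ℂ] LMap B₀ B₁) : Prop where
  superchannel : IsSuperchannel Θ
  map_classical : ∀ E : LMap A₀ A₁, IsClassical E → IsClassical (Θ E)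

/-- An operator `ρ` on `A₁` as a map whose input system is trivial. -/
def preparation {A₁ : Type*} (ρ : Matrix A₁ A₁ ℂ) : LMap Unit A₁ where
  toFun X := X () () • ρ
  map_add' X Y := by simp [add_smul]
  map_smul' c X := by simp [mul_smul]

/-- The (normalized) maximally coherent state `|+⟩⟨+|`, `|+⟩ = m^{-1/2} ∑ᵢ |i⟩`, in dimension
`m`. -/
def plusState (m : ℕ) : Matrix (Fin m) (Fin m) ℂ := Matrix.of fun _ _ => (m : ℂ)⁻¹

/-- The values `log₂ |R₁|` over the static systems `R₁` whose maximally coherent state can be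
converted exactly into `N` by some MISC. -/
def costSet {A₀ A₁ : Type*} [Fintype A₀] [Fintype A₁] [DecidableEq A₀] [DecidableEq A₁]
    (N : LMap A₀ A₁) : Set EReal :=
  {c | ∃ m : ℕ, 0 < m ∧ c = (Real.logb 2 m : ℝ) ∧
    ∃ Θ : LMap Unit (Fin m) →ₗ[ℂ] LMap A₀ A₁, IsMISC Θ ∧ Θ (preparation (plusState m)) = N}

/-- The exact one-shot coherence cost of `N` under MISC. -/
def oneShotCost {A₀ A₁ : Type*} [Fintype A₀] [Fintype A₁] [DecidableEq A₀] [DecidableEq A₁]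
    (N : LMap A₀ A₁) : EReal := sInf (costSet N)

/-- The max-relative entropy `log₂ min {t : t E ≥ N}` of two maps, where the inequality means that
the difference is completely positive; it is `+∞` if there is no such `t`. -/
def Dmax {A₀ A₁ : Type*} (N E : LMap A₀ A₁) : EReal :=
  sInf {d | ∃ t : ℝ, 0 < t ∧ IsCP ((t : ℂ) • E - N) ∧ d = (Real.logb 2 t : ℝ)}

/-- The log-robustness of dynamical coherence. -/
def logRobustness {A₀ A₁ : Type*} [Fintype A₀] [Fintype A₁] [DecidableEq A₀] [DecidableEq A₁]
    (N : LMap A₀ A₁) : EReal := sInf (Dmax N '' {E | IsClassical E})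

/-- The tensor power `N^{⊗ n}`, from `A₀ⁿ` to `A₁ⁿ`: the matrix unit `|p⟩⟨q|` is mapped to
`⨂ᵢ N(|pᵢ⟩⟨qᵢ|)`. -/
def tensorPower {A₀ A₁ : Type*} [Fintype A₀] [DecidableEq A₀] (N : LMap A₀ A₁) (n : ℕ) :
    LMap (Fin n → A₀) (Fin n → A₁) where
  toFun X := Matrix.of fun f g =>
    ∑ p : Fin n → A₀, ∑ q : Fin n → A₀,
      X p q * ∏ i, N (Matrix.single (p i) (q i) 1) (f i) (g i)
  map_add' X Y := by ext f g; simp [add_mul, Finset.sum_add_distrib]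
  map_smul' c X := by ext f g; simp [mul_assoc, Finset.mul_sum]

end DynCoherence

end

/-! ### Positivity of matrices and of their tensor powers -/

namespace DynCoherence

open Matrix

/-! Everything reduces to one number. Through Choi matrices, classical channels become diagonal
matrices of transition probabilities, and `feasible (choi N)` collects the `t` for which `t` times
some classical channel dominates `N`. Compactness gives a least such `l`, and `logb 2 l` is the
log-robustness.

One-shot cost: if a MISC sends `plusState m` to `N`, then applying it to `1 - plusState m ≥ 0` shows
that `m` is feasible, since `1/m` is sent to a classical channel (`IsMISC.mem_feasible`).
Conversely, for a feasible `m > 1`, measuring the effect `plusState m` and preparing `N` or a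
complementary channel is a MISC that produces `N` (`exists_isMISC`). So the cost of `N` is the
logarithm of the least feasible integer, up to rounding.

Multiplicativity: `l ^ n` is feasible for the tensor power, by taking powers of the optimal
classical channel. That nothing smaller is feasible follows from duality: each `μ < l` has a
separating witness `W` by Sion's minimax theorem, and the tensor power of `W` still works because
maximizing `W` over transition matrices splits into independent choices, one for each input
(`pow_le_of_mem_feasible_of_notMem`). The rounding error is bounded and vanishes after division by
`n`. -/

lemma ofReal_re_of_nonneg {z : ℂ} (hz : 0 ≤ z) : (z.re : ℂ) = z :=
  (Complex.eq_re_of_ofReal_le (r := 0) (by simpa using hz)).symm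

lemma sum_mul_nonneg_of_posSemidef {α : Type*} [Fintype α] {M : Matrix α α ℂ}
    (hM : M.PosSemidef) (x : α → ℂ) : 0 ≤ ∑ p, ∑ q, star (x p) * M p q * x q := by
  have h := hM.dotProduct_mulVec_nonneg x
  simpa [dotProduct, mulVec, Finset.mul_sum, mul_assoc] using h

/-- The quadratic form at `x` is that of the pulled-back `K` at the vector `(i, b) ↦ x b`. This
covers both applying a map through its Choi matrix and measuring part of an output. -/
lemma posSemidef_contract {ι β γ : Type*} [Fintype ι] [Fintype β] [Fintype γ]
    {K : Matrix γ γ ℂ} (hK : K.PosSemidef) (f : ι → β → γ) :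
    (Matrix.of fun b b' => ∑ i, ∑ j, K (f i b) (f j b')).PosSemidef := by
  refine PosSemidef.of_dotProduct_mulVec_nonneg ?_ fun x => ?_
  · ext b b'
    simp only [conjTranspose_apply, of_apply, star_sum]
    rw [Finset.sum_comm]
    exact Finset.sum_congr rfl fun i _ => Finset.sum_congr rfl fun j _ => hK.1.apply _ _
  · have h := sum_mul_nonneg_of_posSemidef (hK.submatrix fun p : ι × β => f p.1 p.2)
      fun p => x p.2
    refine h.trans_eq ?_
    simp only [Fintype.sum_prod_type, submatrix_apply, dotProduct, mulVec, of_apply, Pi.star_apply,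
      Finset.mul_sum, Finset.sum_mul, mul_assoc]
    rw [Finset.sum_comm]
    refine Finset.sum_congr rfl fun b _ => ?_
    rw [Finset.sum_congr rfl fun i _ => Finset.sum_comm, Finset.sum_comm]

/-- The trace is the sum of all entries of the Hadamard product of `A` with the transpose of `B`,
which is positive by Schur's theorem. -/
lemma trace_mul_nonneg {α : Type*} [Fintype α] {A B : Matrix α α ℂ}
    (hA : A.PosSemidef) (hB : B.PosSemidef) : 0 ≤ (A * B).trace := by
  have h := sum_mul_nonneg_of_posSemidef (hA.hadamard hB.transpose) 1
  simpa [trace, mul_apply] using h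

lemma posSemidef_smul_ofReal {α : Type*} {A : Matrix α α ℂ} (hA : A.PosSemidef) {t : ℝ}
    (ht : 0 ≤ t) : ((t : ℂ) • A).PosSemidef :=
  hA.smul (Complex.zero_le_real.2 ht)

section PiTensor

variable {ι α : Type*} [Fintype ι]

/-- The tensor product of a family of square matrices. -/
def piTensor (M : ι → Matrix α α ℂ) : Matrix (ι → α) (ι → α) ℂ :=
  Matrix.of fun p q => ∏ i, M i (p i) (q i)

lemma piTensor_posSemidef [Fintype α] {M : ι → Matrix α α ℂ}
    (hM : ∀ i, (M i).PosSemidef) : (piTensor M).PosSemidef := by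
  classical
  have key : ∀ s : Finset ι,
      (Matrix.of fun p q : ι → α => ∏ i ∈ s, M i (p i) (q i)).PosSemidef := by
    intro s
    induction s using Finset.induction_on with
    | empty =>
      have h := posSemidef_vecMulVec_self_star (fun _ : ι → α => (1 : ℂ))
      convert h using 1
      ext p q
      simp [vecMulVec_apply]
    | insert i s hi ih =>
      have h := ((hM i).submatrix fun p : ι → α => p i).hadamard ih
      have e : (Matrix.of fun p q : ι → α => ∏ j ∈ insert i s, M j (p j) (q j)) =
          ((M i).submatrix (fun p => p i) fun p => p i) ⊙
            Matrix.of fun p q : ι → α => ∏ j ∈ s, M j (p j) (q j) := by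
        ext p q
        simp [Finset.prod_insert hi]
      rw [e]
      exact h
  exact key Finset.univ

lemma trace_piTensor_mul [Fintype α] [DecidableEq ι] (M M' : ι → Matrix α α ℂ) :
    (piTensor M * piTensor M').trace = ∏ i, (M i * M' i).trace := by
  simp only [trace, diag_apply, mul_apply, piTensor, of_apply, ← Finset.prod_mul_distrib,
    Fintype.prod_sum]

/-- Expanding the power of `A = B + (A - B)` over subsets gives products of positive factors;
subtracting the power of `B` removes the term of the full subset. -/
lemma piTensor_sub_posSemidef [Fintype α] {A B : Matrix α α ℂ}
    (hB : B.PosSemidef) (hAB : (A - B).PosSemidef) :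
    (piTensor (fun _ : ι => A) - piTensor fun _ => B).PosSemidef := by
  classical
  have h : piTensor (fun _ : ι => A) - piTensor (fun _ => B) =
      ∑ t ∈ (Finset.univ : Finset ι).powerset.erase Finset.univ,
        piTensor fun i => if i ∈ t then B else A - B := by
    rw [Finset.sum_erase_eq_sub (by simp)]
    congr 1
    · ext p q
      simp only [Matrix.sum_apply, piTensor, of_apply]
      have e := Finset.prod_add (fun i : ι => B (p i) (q i)) (fun i => (A - B) (p i) (q i))
        Finset.univ
      simp only [Matrix.sub_apply, add_sub_cancel] at e
      rw [e]
      refine Finset.sum_congr rfl fun t _ => ?_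
      rw [← Finset.prod_sdiff (Finset.subset_univ t), mul_comm]
      congr 1
      · exact Finset.prod_congr rfl fun i hi => by simp [(Finset.mem_sdiff.1 hi).2]
      · exact Finset.prod_congr rfl fun i hi => by simp [hi]
    · simp
  rw [h]
  refine posSemidef_sum _ fun t _ => piTensor_posSemidef fun i => ?_
  split_ifs
  exacts [hB, hAB]

end PiTensor

/-! ### Choi matrices -/

section Choi

variable {A₀ A₁ : Type*}

lemma block_apply {R A : Type*} (r s : R) (X : Matrix (R × A) (R × A) ℂ) (a b : A) :
    block r s X a b = X (r, a) (s, b) := rfl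

/-- The Choi matrix of a linear map. -/
def choi [DecidableEq A₀] (Φ : LMap A₀ A₁) : Matrix (A₀ × A₁) (A₀ × A₁) ℂ :=
  Matrix.of fun p q => Φ (Matrix.single p.1 q.1 1) p.2 q.2

@[simp] lemma choi_apply [DecidableEq A₀] (Φ : LMap A₀ A₁) (p q : A₀ × A₁) :
    choi Φ p q = Φ (Matrix.single p.1 q.1 1) p.2 q.2 := rfl

lemma choi_add [DecidableEq A₀] (Φ Ψ : LMap A₀ A₁) : choi (Φ + Ψ) = choi Φ + choi Ψ := rfl

lemma choi_sub [DecidableEq A₀] (Φ Ψ : LMap A₀ A₁) : choi (Φ - Ψ) = choi Φ - choi Ψ := rfl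

lemma choi_smul [DecidableEq A₀] (c : ℂ) (Φ : LMap A₀ A₁) : choi (c • Φ) = c • choi Φ := rfl

variable [Fintype A₀] [DecidableEq A₀]

lemma apply_eq_sum_choi (Φ : LMap A₀ A₁) (X : Matrix A₀ A₀ ℂ) (a b : A₁) :
    Φ X a b = ∑ i, ∑ j, X i j * choi Φ (i, a) (j, b) := by
  conv_lhs => rw [matrix_eq_sum_single X]
  simp only [map_sum, Matrix.sum_apply, choi_apply]
  refine Finset.sum_congr rfl fun i _ => Finset.sum_congr rfl fun j _ => ?_
  rw [show single i j (X i j) = X i j • single i j (1 : ℂ) by simp, map_smul]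
  rfl

lemma lmap_ext_choi {Φ Ψ : LMap A₀ A₁} (h : choi Φ = choi Ψ) : Φ = Ψ := by
  ext X a b
  simp only [apply_eq_sum_choi, h]

/-- The Choi matrix is, up to relabelling, the ampliation applied to the unnormalized maximally
entangled state `v v*`. The enumeration `e` supplies a reference of the form `Fin k`. -/
lemma IsCP.choi_posSemidef {Φ : LMap A₀ A₁} (h : IsCP Φ) : (choi Φ).PosSemidef := by
  let e := Fintype.equivFin A₀
  let v : Fin (Fintype.card A₀) × A₀ → ℂ := fun p => if e p.2 = p.1 then 1 else 0
  have h1 := (h _ _ (posSemidef_vecMulVec_self_star v)).submatrix fun p : A₀ × A₁ => (e p.1, p.2)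
  convert h1 using 1
  ext ⟨i, a⟩ ⟨j, b⟩
  simp only [choi_apply, ampliation, submatrix_apply, LinearMap.coe_mk, AddHom.coe_mk, of_apply]
  refine congrFun (congrFun (congrArg Φ (Matrix.ext fun k l => ?_)) a) b
  simp [block_apply, vecMulVec_apply, v, single_apply, ite_and, eq_comm]
  split_ifs <;> rfl

lemma ampliation_apply {R : Type*} (Φ : LMap A₀ A₁)
    (X : Matrix (R × A₀) (R × A₀) ℂ) (p q : R × A₁) :
    ampliation R Φ X p q = ∑ i, ∑ j, X (p.1, i) (q.1, j) * choi Φ (i, p.2) (j, q.2) :=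
  apply_eq_sum_choi Φ _ _ _

variable [Fintype A₁]

/-- The output is a contraction of the positive matrix `X ⊗ choi Φ`. -/
lemma ampliation_posSemidef {R : Type*} [Fintype R] {Φ : LMap A₀ A₁} (h : (choi Φ).PosSemidef)
    {X : Matrix (R × A₀) (R × A₀) ℂ} (hX : X.PosSemidef) : (ampliation R Φ X).PosSemidef := by
  convert posSemidef_contract (hX.kronecker h)
    (fun (i : A₀) (p : R × A₁) => ((p.1, i), (i, p.2))) using 1
  ext p q
  simp only [ampliation_apply, of_apply, kroneckerMap_apply]

lemma isCP_iff_choi {Φ : LMap A₀ A₁} : IsCP Φ ↔ (choi Φ).PosSemidef :=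
  ⟨IsCP.choi_posSemidef, fun h _ _ hX => ampliation_posSemidef h hX⟩

lemma isChannel_iff {Φ : LMap A₀ A₁} : IsChannel Φ ↔ (choi Φ).PosSemidef ∧
    ∀ i j, ∑ a, choi Φ (i, a) (j, a) = if i = j then 1 else 0 := by
  constructor
  · intro h
    refine ⟨h.cp.choi_posSemidef, fun i j => ?_⟩
    have := h.tp (single i j 1)
    rw [trace] at this
    simp only [diag_apply] at this
    simp only [choi_apply, this]
    split_ifs with hij
    · subst hij; simp
    · exact trace_single_eq_of_ne _ _ _ hij
  · rintro ⟨h1, h2⟩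
    refine ⟨isCP_iff_choi.2 h1, fun X => ?_⟩
    simp only [trace, diag_apply, apply_eq_sum_choi]
    rw [Finset.sum_comm]
    refine Finset.sum_congr rfl fun i _ => ?_
    rw [Finset.sum_comm]
    simp [← Finset.mul_sum, h2, -choi_apply]

end Choi

end DynCoherence

/-! ### Classical channels as transition matrices -/

namespace DynCoherence

open Matrix

section Stochastic

variable {A₀ A₁ : Type*} [Fintype A₁]

/-- Transition probabilities `d (x, y)` from `x` to `y`. -/
def stochastic (A₀ A₁ : Type*) [Fintype A₁] : Set (A₀ × A₁ → ℝ) :=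
  {d | (∀ p, 0 ≤ d p) ∧ ∀ x, ∑ y, d (x, y) = 1}

lemma convex_stochastic : Convex ℝ (stochastic A₀ A₁) := by
  rintro d ⟨hd0, hd⟩ e ⟨he0, he⟩ a b ha hb hab
  refine ⟨fun p => add_nonneg (mul_nonneg ha (hd0 p)) (mul_nonneg hb (he0 p)), fun x => ?_⟩
  simp [Finset.sum_add_distrib, ← Finset.mul_sum, hd, he, hab]

lemma isCompact_stochastic : IsCompact (stochastic A₀ A₁) := by
  refine (isCompact_univ_pi fun _ : A₀ × A₁ =>
    isCompact_Icc (a := (0 : ℝ)) (b := 1)).of_isClosed_subset ?_ ?_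
  · simp only [stochastic, Set.ofPred_and, Set.ofPred_forall]
    refine (isClosed_iInter fun p => isClosed_le continuous_const (by fun_prop)).inter
      (isClosed_iInter fun x => isClosed_eq (by fun_prop) continuous_const)
  · rintro d ⟨h0, h1⟩ ⟨x, y⟩ -
    refine ⟨h0 _, (h1 x).symm ▸ ?_⟩
    exact Finset.single_le_sum (f := fun y => d (x, y)) (fun y _ => h0 (x, y)) (Finset.mem_univ y)

lemma indicator_mem_stochastic [DecidableEq A₁] (f : A₀ → A₁) :
    (fun p : A₀ × A₁ => if p.2 = f p.1 then (1 : ℝ) else 0) ∈ stochastic A₀ A₁ :=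
  ⟨fun p => by dsimp only; split_ifs <;> norm_num, fun x => by simp⟩

variable [Fintype A₀] [DecidableEq A₀] [DecidableEq A₁]

/-- The diagonal matrix with real entries `d`. -/
abbrev diagR {α : Type*} [DecidableEq α] (d : α → ℝ) : Matrix α α ℂ :=
  diagonal fun p => (d p : ℂ)

/-- The classical map with transition matrix `d`. -/
def classicalMap (d : A₀ × A₁ → ℝ) : LMap A₀ A₁ where
  toFun X := diagonal fun y => ∑ x, X x x * (d (x, y) : ℂ)
  map_add' X Y := by
    rw [diagonal_add]
    simp [add_mul, Finset.sum_add_distrib]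
  map_smul' c X := by
    rw [RingHom.id_apply, ← diagonal_smul]
    congr 1
    ext y
    simp [Finset.mul_sum, mul_assoc]

omit [Fintype A₁] in
lemma choi_classicalMap (d : A₀ × A₁ → ℝ) : choi (classicalMap d) = diagR d := by
  ext ⟨i, a⟩ ⟨j, b⟩
  by_cases hij : i = j
  · subst hij
    by_cases hab : a = b
    · subst hab
      simp [classicalMap, single_apply]
    · simp [classicalMap, hab]
  · have : ∀ x, ¬ (i = x ∧ j = x) := by rintro x ⟨rfl, h⟩; exact hij h.symm
    simp [classicalMap, hij, this, diagonal_apply]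

lemma isClassical_classicalMap {d : A₀ × A₁ → ℝ} (hd : d ∈ stochastic A₀ A₁) :
    IsClassical (classicalMap d) := by
  refine ⟨isChannel_iff.2 ⟨?_, fun i j => ?_⟩, ?_⟩
  · rw [choi_classicalMap]
    exact PosSemidef.diagonal fun p => Complex.zero_le_real.2 (hd.1 p)
  · rw [choi_classicalMap]
    split_ifs with h
    · subst h
      simp only [diagonal_apply_eq]
      exact_mod_cast hd.2 i
    · exact Finset.sum_eq_zero fun a _ => diagonal_apply_ne _ (by simp [h])
  · ext X a b
    simp [classicalMap, dephasing]

/-- Input dephasing kills the Choi entries with `i ≠ j` and output dephasing those with `a ≠ b`, so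
only a nonnegative diagonal survives, normalized by trace preservation. -/
lemma IsClassical.exists_eq {E : LMap A₀ A₁} (hE : IsClassical E) :
    ∃ d ∈ stochastic A₀ A₁, E = classicalMap d := by
  obtain ⟨h1, h2⟩ := isChannel_iff.1 hE.channel
  have hre : ∀ p, ((choi E p p).re : ℂ) = choi E p p := fun p => ofReal_re_of_nonneg h1.diag_nonneg
  refine ⟨fun p => (choi E p p).re, ⟨fun p => ?_, fun x => ?_⟩, ?_⟩
  · exact (Complex.nonneg_iff.1 (h1.diag_nonneg (i := p))).1
  · have := congrArg Complex.re (h2 x x)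
    simpa using this
  · refine lmap_ext_choi ?_
    rw [choi_classicalMap]
    ext ⟨i, a⟩ ⟨j, b⟩
    rw [show diagR _ _ _ = _ from diagonal_apply ..]
    split_ifs with h
    · rw [← h, hre]
    · rw [choi_apply, hE.dephased]
      by_cases hab : a = b
      · have hij : i ≠ j := fun hij => h (by rw [hij, hab])
        have : diagonal (diag (single i j (1 : ℂ))) = 0 := by
          simp [hij]
        simp [dephasing, this]
      · simp [dephasing, hab]

omit [Fintype A₁] in
lemma choi_smul_classicalMap_sub (N : LMap A₀ A₁) (t : ℝ) (d : A₀ × A₁ → ℝ) :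
    choi ((t : ℂ) • classicalMap d - N) = (t : ℂ) • diagR d - choi N := by
  rw [choi_sub, choi_smul, choi_classicalMap]

end Stochastic

section Closed

lemma isClosed_posSemidef {α : Type*} [Fintype α] :
    IsClosed {M : Matrix α α ℂ | M.PosSemidef} := by
  simp only [posSemidef_iff_dotProduct_mulVec, Set.ofPred_and, Set.ofPred_forall]
  refine IsClosed.inter (isClosed_eq (by fun_prop) continuous_id)
    (isClosed_iInter fun x => isClosed_le continuous_const (by fun_prop))

open scoped MatrixOrder Matrix.Norms.L2Operator in
lemma exists_smul_one_sub_posSemidef {α : Type*} [Fintype α] [DecidableEq α] {M : Matrix α α ℂ}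
    (hM : M.IsHermitian) : ∃ t : ℝ, 0 ≤ t ∧ ((t : ℂ) • (1 : Matrix α α ℂ) - M).PosSemidef := by
  refine ⟨‖M‖, norm_nonneg _, ?_⟩
  have h := IsSelfAdjoint.le_algebraMap_norm_self (a := M) hM
  rw [Matrix.le_iff, Algebra.algebraMap_eq_smul_one] at h
  exact h

end Closed

end DynCoherence

/-! ### Feasible multiples and their dual certificates -/

namespace DynCoherence

open Matrix

section Feasible

variable {A₀ A₁ : Type*} [Fintype A₁] [DecidableEq A₀] [DecidableEq A₁]

/-- The real numbers `t` for which `t` times some classical channel dominates the map with Choi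
matrix `J`. -/
def feasible (J : Matrix (A₀ × A₁) (A₀ × A₁) ℂ) : Set ℝ :=
  {t | ∃ d ∈ stochastic A₀ A₁, ((t : ℂ) • diagR d - J).PosSemidef}

lemma diagR_posSemidef {α : Type*} [DecidableEq α] {d : α → ℝ} (hd : ∀ p, 0 ≤ d p) :
    (diagR d).PosSemidef :=
  PosSemidef.diagonal fun p => Complex.zero_le_real.2 (hd p)

variable {J : Matrix (A₀ × A₁) (A₀ × A₁) ℂ}

/-- Summing the diagonal over the outputs of a single input leaves `t - 1 ≥ 0`. -/
lemma one_le_of_mem_feasible [Nonempty A₀] (hJ1 : ∀ i, ∑ a, J (i, a) (i, a) = 1) {t : ℝ}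
    (ht : t ∈ feasible J) : 1 ≤ t := by
  obtain ⟨d, hd, h⟩ := ht
  obtain ⟨x⟩ := ‹Nonempty A₀›
  have h1 : 0 ≤ ∑ y, ((t : ℂ) • diagR d - J) (x, y) (x, y) :=
    Finset.sum_nonneg fun y _ => h.diag_nonneg
  have h2 : ∑ y, ((t : ℂ) • diagR d - J) (x, y) (x, y) = ((t - 1 : ℝ) : ℂ) := by
    have h3 : ∑ y, (d (x, y) : ℂ) = 1 := by exact_mod_cast hd.2 x
    simp [Finset.sum_sub_distrib, hJ1, ← Finset.mul_sum, h3]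
  rw [h2, Complex.zero_le_real] at h1
  linarith

omit [DecidableEq A₀] [DecidableEq A₁] in
lemma nonempty_of_sum_eq_one [Nonempty A₀] (hJ1 : ∀ i, ∑ a, J (i, a) (i, a) = 1) :
    Nonempty A₁ := by
  obtain ⟨x⟩ := ‹Nonempty A₀›
  by_contra h
  rw [not_nonempty_iff] at h
  simpa using hJ1 x

variable [Fintype A₀]

lemma feasible_nonempty [Nonempty A₁] (hJ : J.IsHermitian) : (feasible J).Nonempty := by
  obtain ⟨t, -, h⟩ := exists_smul_one_sub_posSemidef hJ
  -- The uniform channel has Choi matrix `1 / |A₁|`, so `|A₁|` times it is the identity.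
  have hc : (Fintype.card A₁ : ℝ) ≠ 0 := by simp
  refine ⟨t * Fintype.card A₁, fun _ => (Fintype.card A₁ : ℝ)⁻¹,
    ⟨fun _ => by positivity, fun x => by simp⟩, ?_⟩
  convert h using 2
  ext p q
  rw [Matrix.smul_apply, Matrix.smul_apply, diagR, diagonal_apply, one_apply]
  split_ifs
  · simp
  · simp

lemma exists_isLeast_feasible [Nonempty A₀] (hJ : J.IsHermitian)
    (hJ1 : ∀ i, ∑ a, J (i, a) (i, a) = 1) : ∃ l, IsLeast (feasible J) l := by
  have := nonempty_of_sum_eq_one hJ1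
  obtain ⟨t₀, ht₀⟩ := feasible_nonempty hJ
  -- Bounding `t` by one feasible value `t₀` makes the set of feasible pairs compact.
  let K : Set (ℝ × (A₀ × A₁ → ℝ)) := (Set.Icc 1 t₀ ×ˢ stochastic A₀ A₁) ∩
    {x | ((x.1 : ℂ) • diagR x.2 - J).PosSemidef}
  have hK : IsCompact K := by
    refine (isCompact_Icc.prod isCompact_stochastic).inter_right ?_
    refine isClosed_posSemidef.preimage
      (f := fun x : ℝ × (A₀ × A₁ → ℝ) => (x.1 : ℂ) • diagR x.2 - J) ?_
    unfold diagR
    fun_prop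
  obtain ⟨d₀, hd₀, hp₀⟩ := id ht₀
  have hne : K.Nonempty :=
    ⟨(t₀, d₀), ⟨⟨⟨one_le_of_mem_feasible hJ1 ht₀, le_rfl⟩, hd₀⟩, hp₀⟩⟩
  obtain ⟨⟨l, d⟩, hl, hmin⟩ := hK.exists_isMinOn hne continuous_fst.continuousOn
  refine ⟨l, ⟨d, hl.1.2, hl.2⟩, fun t ht => ?_⟩
  rcases le_total t t₀ with h | h
  · obtain ⟨d', hd', hp'⟩ := id ht
    exact hmin (show (t, d') ∈ K from ⟨⟨⟨one_le_of_mem_feasible hJ1 ht, h⟩, hd'⟩, hp'⟩)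
  · exact hl.1.1.2.trans h

/-- Infeasibility certificates: if `μ` is not feasible, some positive semidefinite `W`
separates `J` from all multiples `μ • E` of classical channels. -/
lemma exists_dual_of_notMem_feasible [Nonempty A₁] (hJ : J.IsHermitian) {μ : ℝ}
    (hμ : μ ∉ feasible J) : ∃ W : Matrix (A₀ × A₁) (A₀ × A₁) ℂ, W.PosSemidef ∧
      ∀ d ∈ stochastic A₀ A₁, μ * (W * diagR d).trace.re < (W * J).trace.re := by
  -- The entry bound truncates the positive cone to a compact convex set, as the minimax theorem
  -- needs; any positive matrix enters it after rescaling.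
  let Y : Set (Matrix (A₀ × A₁) (A₀ × A₁) ℂ) := {W | W.PosSemidef ∧ ∀ p q, ‖W p q‖ ≤ 1}
  let f : (A₀ × A₁ → ℝ) → Matrix (A₀ × A₁) (A₀ × A₁) ℂ → ℝ := fun d W =>
    (W * (J - (μ : ℂ) • diagR d)).trace.re
  have hf : Continuous fun x : (A₀ × A₁ → ℝ) × Matrix (A₀ × A₁) (A₀ × A₁) ℂ => f x.1 x.2 := by
    simp only [f, diagR]
    fun_prop
  have hY : IsCompact Y := by
    refine (isCompact_univ_pi fun _ => isCompact_univ_pi fun _ =>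
      isCompact_closedBall (0 : ℂ) 1).of_isClosed_subset ?_ ?_
    · simp only [Y, Set.ofPred_and, Set.ofPred_forall]
      refine isClosed_posSemidef.inter (isClosed_iInter fun p => isClosed_iInter fun q =>
        isClosed_le (by fun_prop) continuous_const)
    · rintro W hW p - q -
      simpa using hW.2 p q
  have hYc : Convex ℝ Y := by
    rintro W ⟨hW, hW'⟩ V ⟨hV, hV'⟩ a b ha hb hab
    refine ⟨(hW.smul ha).add (hV.smul hb), fun p q => ?_⟩
    refine (norm_add_le _ _).trans ?_
    simp only [Matrix.smul_apply, norm_smul, Real.norm_of_nonneg ha, Real.norm_of_nonneg hb]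
    nlinarith [hW' p q, hV' p q]
  have hY0 : Y.Nonempty := ⟨0, PosSemidef.zero, by simp⟩
  have hX0 : (stochastic A₀ A₁).Nonempty :=
    ⟨_, indicator_mem_stochastic fun _ => Classical.arbitrary A₁⟩
  obtain ⟨a, ha, W, hW, hsad⟩ := Sion.exists_isSaddlePointOn' (f := f) hX0 isCompact_stochastic
    (fun W _ => (hf.comp (.prodMk continuous_id continuous_const)).continuousOn.lowerSemicontinuousOn)
    (fun W _ => by
      refine ConvexOn.quasiconvexOn ⟨convex_stochastic, fun d _ e _ s t _ _ hst => le_of_eq ?_⟩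
      have : J - (μ : ℂ) • diagR (s • d + t • e) =
          s • (J - (μ : ℂ) • diagR d) + t • (J - (μ : ℂ) • diagR e) := by
        have h : diagR (s • d + t • e) = s • diagR d + t • diagR e := by
          ext p q
          simp only [diagR, diagonal_apply, Matrix.add_apply, Matrix.smul_apply]
          split_ifs <;> simp
        rw [h, smul_sub, smul_sub, smul_add, smul_comm (μ : ℂ) s, smul_comm (μ : ℂ) t]
        nth_rewrite 1 [← one_smul ℝ J]
        rw [← hst, add_smul]
        abel
      simp only [f, this]
      simp [Matrix.mul_add])
    hYc hY
    (fun d _ => (hf.comp (.prodMk continuous_const continuous_id)).continuousOn.upperSemicontinuousOn)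
    (fun d _ => by
      refine ConcaveOn.quasiconcaveOn ⟨hYc, fun V _ W _ s t _ _ hst => le_of_eq ?_⟩
      simp [f, Matrix.add_mul])
    convex_stochastic hY0
  refine ⟨W, hW.1, fun d hd => ?_⟩
  -- At the saddle point `(a, W)`, infeasibility of `μ` for `a` gives some `V` with `f a V > 0`. The
  -- saddle inequality `f a V ≤ f d W` then makes the single `W` work for all `d`.
  have hpos : ∃ V ∈ Y, 0 < f a V := by
    have hn : ¬ ((μ : ℂ) • diagR a - J).PosSemidef := fun h => hμ ⟨a, ha, h⟩
    have hH : ((μ : ℂ) • diagR a - J).IsHermitian :=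
      ((diagR_posSemidef ha.1).1.smul (Complex.conj_ofReal μ)).sub hJ
    rw [posSemidef_iff_dotProduct_mulVec, not_and] at hn
    have hn := hn hH
    push Not at hn
    obtain ⟨v, hv⟩ := hn
    have hv' : (star v ⬝ᵥ ((μ : ℂ) • diagR a - J) *ᵥ v).re < 0 := by
      by_contra h
      refine hv (Complex.nonneg_iff.2 ⟨not_lt.1 h, ?_⟩)
      exact (hH.im_star_dotProduct_mulVec_self v).symm
    -- This scaling brings the projector onto a negative direction `v` into `Y`; the added `1` keeps
    -- the denominator positive.
    let c : ℝ := (1 + ∑ p, ∑ q, ‖vecMulVec v (star v) p q‖)⁻¹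
    have hc : 0 < c := by positivity
    refine ⟨c • vecMulVec v (star v), ⟨(posSemidef_vecMulVec_self_star v).smul hc.le,
      fun p q => ?_⟩, ?_⟩
    · rw [Matrix.smul_apply, norm_smul, Real.norm_of_nonneg hc.le, inv_mul_le_one₀ (by positivity)]
      have h1 := Finset.single_le_sum (f := fun q => ‖vecMulVec v (star v) p q‖)
        (fun q _ => norm_nonneg _) (Finset.mem_univ q)
      have h2 := Finset.single_le_sum (f := fun p => ∑ q, ‖vecMulVec v (star v) p q‖)
        (fun p _ => by positivity) (Finset.mem_univ p)
      linarith
    · have h3 : f a (c • vecMulVec v (star v)) =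
          c * -(star v ⬝ᵥ ((μ : ℂ) • diagR a - J) *ᵥ v).re := by
        simp only [f]
        rw [← neg_sub ((μ : ℂ) • diagR a) J, Matrix.smul_mul, trace_smul, Matrix.mul_neg,
          vecMulVec_mul, trace_neg, trace_vecMulVec, dotProduct_comm, ← dotProduct_mulVec]
        simp
      rw [h3]
      exact mul_pos hc (neg_pos.2 hv')
  obtain ⟨V, hV, hV0⟩ := hpos
  have h := hV0.trans_le (hsad d hd V hV)
  simp only [f, Matrix.mul_sub, trace_sub, Matrix.mul_smul, trace_smul, smul_eq_mul,
    Complex.sub_re, Complex.re_ofReal_mul] at h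
  linarith

end Feasible

end DynCoherence

/-! ### Multiplicativity under tensor powers -/

namespace DynCoherence

open Matrix Filter Topology

section Power

variable {A₀ A₁ : Type*}

/-- The tensor power of a matrix on a composite system, with the factors regrouped. -/
def pairPower (J : Matrix (A₀ × A₁) (A₀ × A₁) ℂ) (n : ℕ) :
    Matrix ((Fin n → A₀) × (Fin n → A₁)) ((Fin n → A₀) × (Fin n → A₁)) ℂ :=
  (piTensor fun _ : Fin n => J).submatrix (Equiv.arrowProdEquivProdArrow (Fin n) _ _).symm
    (Equiv.arrowProdEquivProdArrow (Fin n) _ _).symm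

lemma pairPower_apply (J : Matrix (A₀ × A₁) (A₀ × A₁) ℂ) (n : ℕ)
    (p q : (Fin n → A₀) × (Fin n → A₁)) :
    pairPower J n p q = ∏ i, J (p.1 i, p.2 i) (q.1 i, q.2 i) := rfl

lemma pairPower_smul (c : ℂ) (J : Matrix (A₀ × A₁) (A₀ × A₁) ℂ) (n : ℕ) :
    pairPower (c • J) n = c ^ n • pairPower J n := by
  ext p q
  simp [pairPower_apply, Finset.prod_mul_distrib]

variable [Fintype A₀] [Fintype A₁]

lemma pairPower_posSemidef {J : Matrix (A₀ × A₁) (A₀ × A₁) ℂ} (hJ : J.PosSemidef) (n : ℕ) :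
    (pairPower J n).PosSemidef :=
  (piTensor_posSemidef fun _ => hJ).submatrix _

lemma pairPower_sub_posSemidef {A B : Matrix (A₀ × A₁) (A₀ × A₁) ℂ} (hB : B.PosSemidef)
    (hAB : (A - B).PosSemidef) (n : ℕ) : (pairPower A n - pairPower B n).PosSemidef :=
  (piTensor_sub_posSemidef hB hAB).submatrix
    (Equiv.arrowProdEquivProdArrow (Fin n) (fun _ => A₀) fun _ => A₁).symm

lemma trace_pairPower_mul (A B : Matrix (A₀ × A₁) (A₀ × A₁) ℂ) (n : ℕ) :
    (pairPower A n * pairPower B n).trace = (A * B).trace ^ n := by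
  rw [pairPower, pairPower, submatrix_mul_equiv]
  have := trace_piTensor_mul (fun _ : Fin n => A) (fun _ => B)
  rw [Finset.prod_const, Finset.card_univ, Fintype.card_fin] at this
  rw [← this]
  exact Equiv.sum_comp (Equiv.arrowProdEquivProdArrow (Fin n) (fun _ => A₀) fun _ => A₁).symm
    ((piTensor fun _ : Fin n => A) * piTensor fun _ => B).diag

variable [DecidableEq A₀] [DecidableEq A₁]

/-- The tensor power of a transition matrix. -/
def stochasticPower (d : A₀ × A₁ → ℝ) (n : ℕ) : (Fin n → A₀) × (Fin n → A₁) → ℝ :=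
  fun p => ∏ i, d (p.1 i, p.2 i)

omit [Fintype A₀] [DecidableEq A₀] [DecidableEq A₁] in
lemma stochasticPower_mem {d : A₀ × A₁ → ℝ} (hd : d ∈ stochastic A₀ A₁) (n : ℕ) :
    stochasticPower d n ∈ stochastic (Fin n → A₀) (Fin n → A₁) := by
  refine ⟨fun p => Finset.prod_nonneg fun i _ => hd.1 _, fun x => ?_⟩
  simp only [stochasticPower]
  rw [← Fintype.prod_sum (f := fun i y => d (x i, y))]
  simp [hd.2]

omit [Fintype A₀] [Fintype A₁] in
lemma pairPower_diagR (d : A₀ × A₁ → ℝ) (n : ℕ) :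
    pairPower (diagR d) n = diagR (stochasticPower d n) := by
  ext p q
  rw [pairPower_apply, show diagR _ p q = _ from diagonal_apply ..]
  split_ifs with h
  · subst h
    simp [stochasticPower]
  · have : ∃ i, (p.1 i, p.2 i) ≠ (q.1 i, q.2 i) := by
      by_contra! h'
      simp only [Prod.mk.injEq] at h'
      exact h (Prod.ext (funext fun i => (h' i).1) (funext fun i => (h' i).2))
    obtain ⟨i, hi⟩ := this
    exact Finset.prod_eq_zero (Finset.mem_univ i) (diagonal_apply_ne _ hi)

lemma trace_mul_diagR_re {α : Type*} [Fintype α] [DecidableEq α] (W : Matrix α α ℂ) (d : α → ℝ) :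
    (W * diagR d).trace.re = ∑ p, (W p p).re * d p := by
  simp [trace, mul_diagonal]

variable {J : Matrix (A₀ × A₁) (A₀ × A₁) ℂ}

/-- The best transition matrix against `W` is deterministic, sending `x` to the `y` that maximizes
the diagonal of `W`, with value `s`. Against the power of `W` no transition matrix exceeds `s ^ n`,
whereas the power of `J` scores `tr (W J) ^ n`, and `tr (W J) > μ * s`. -/
lemma pow_le_of_mem_feasible_of_notMem [Nonempty A₁] (hJ : J.PosSemidef) {μ : ℝ} (hμ0 : 0 ≤ μ)
    (hμ : μ ∉ feasible J) {n : ℕ} {t : ℝ} (ht0 : 1 ≤ t) (ht : t ∈ feasible (pairPower J n)) :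
    μ ^ n ≤ t := by
  obtain ⟨W, hW, hWd⟩ := exists_dual_of_notMem_feasible hJ.1 hμ
  obtain ⟨d, hd, hp⟩ := ht
  have hmax : ∀ x, ∃ y, ∀ y', (W (x, y') (x, y')).re ≤ (W (x, y) (x, y)).re := fun x =>
    Finite.exists_max fun y => (W (x, y) (x, y)).re
  choose g hg using hmax
  have hdiag : ∀ p, 0 ≤ (W p p).re := fun p => (Complex.nonneg_iff.1 hW.diag_nonneg).1
  have hreal : ∀ p, ((W p p).re : ℂ) = W p p := fun p => ofReal_re_of_nonneg hW.diag_nonneg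
  set s := ∑ x, (W (x, g x) (x, g x)).re with hs
  have hs0 : 0 ≤ s := Finset.sum_nonneg fun x _ => hdiag _
  have h1 : μ * s < (W * J).trace.re := by
    have h := hWd _ (indicator_mem_stochastic g)
    rw [trace_mul_diagR_re, Fintype.sum_prod_type] at h
    simpa using h
  have hWJ : (((W * J).trace.re : ℝ) : ℂ) = (W * J).trace :=
    ofReal_re_of_nonneg (trace_mul_nonneg hW hJ)
  have h2 : (W * J).trace.re ^ n ≤ t * ∑ p, (pairPower W n p p).re * d p := by
    have h := (Complex.nonneg_iff.1 (trace_mul_nonneg (pairPower_posSemidef hW n) hp)).1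
    rw [Matrix.mul_sub, trace_sub, Matrix.mul_smul, trace_smul, trace_pairPower_mul, ← hWJ,
      Complex.sub_re, smul_eq_mul, Complex.re_ofReal_mul, trace_mul_diagR_re,
      ← Complex.ofReal_pow, Complex.ofReal_re] at h
    linarith
  have h3 : ∑ p, (pairPower W n p p).re * d p ≤ s ^ n := by
    have h4 : ∀ p, (pairPower W n p p).re ≤
        ∏ i, (W (p.1 i, g (p.1 i)) (p.1 i, g (p.1 i))).re := by
      intro p
      rw [pairPower_apply, ← Finset.prod_congr rfl fun i _ => hreal (p.1 i, p.2 i),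
        ← Complex.ofReal_prod, Complex.ofReal_re]
      exact Finset.prod_le_prod (fun i _ => hdiag _) fun i _ => hg _ _
    refine (Finset.sum_le_sum fun p _ => mul_le_mul_of_nonneg_right (h4 p) (hd.1 p)).trans ?_
    rw [Fintype.sum_prod_type]
    simp only [← Finset.mul_sum, hd.2, mul_one]
    rw [← Fintype.prod_sum (f := fun (_ : Fin n) x => (W (x, g x) (x, g x)).re)]
    simp [hs]
  have h4 : (W * J).trace.re ^ n ≤ t * s ^ n :=
    h2.trans (mul_le_mul_of_nonneg_left h3 (by linarith))
  rcases Nat.eq_zero_or_pos n with rfl | hn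
  · simpa using ht0
  -- If `s = 0`, then `tr (W J) > 0` contradicts the bound `tr (W J) ^ n ≤ 0`; otherwise `s ^ n`
  -- cancels.
  rcases hs0.eq_or_lt with h0 | h0
  · rw [← h0, zero_pow hn.ne', mul_zero] at h4
    rw [← h0, mul_zero] at h1
    exact absurd h4 (not_le.2 (pow_pos h1 n))
  · have h5 : μ ^ n * s ^ n ≤ t * s ^ n := by
      rw [← mul_pow]
      exact (pow_le_pow_left₀ (by positivity) h1.le n).trans h4
    exact le_of_mul_le_mul_right h5 (pow_pos h0 n)

/-- Certificates exist only strictly below `l`, so the bound is obtained for `μ < l` and passed to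
the limit. -/
lemma pow_le_of_isLeast_feasible [Nonempty A₁] (hJ : J.PosSemidef) {l : ℝ} (hl0 : 0 < l)
    (hl : IsLeast (feasible J) l) {n : ℕ} {t : ℝ} (ht0 : 1 ≤ t)
    (ht : t ∈ feasible (pairPower J n)) : l ^ n ≤ t := by
  have h : Tendsto (fun μ : ℝ => μ ^ n) (𝓝[<] l) (𝓝 (l ^ n)) :=
    ((continuous_pow n).tendsto l).mono_left nhdsWithin_le_nhds
  refine le_of_tendsto h ?_
  filter_upwards [Ioo_mem_nhdsLT hl0] with μ hμ
  exact pow_le_of_mem_feasible_of_notMem hJ hμ.1.le (fun hm => absurd (hl.2 hm) (not_le.2 hμ.2))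
    ht0 ht

omit [Fintype A₁] [DecidableEq A₁] in
lemma choi_tensorPower (N : LMap A₀ A₁) (n : ℕ) :
    choi (tensorPower N n) = pairPower (choi N) n := by
  ext ⟨p, f⟩ ⟨q, g⟩
  simp only [choi_apply, tensorPower, LinearMap.coe_mk, AddHom.coe_mk, of_apply, pairPower_apply]
  rw [Finset.sum_eq_single p, Finset.sum_eq_single q]
  · simp
  · intro q' _ h
    simp [h.symm]
  · simp
  · intro p' _ h
    refine Finset.sum_eq_zero fun q' _ => ?_
    simp [h.symm]
  · simp

omit [DecidableEq A₁] in
lemma isChannel_tensorPower {N : LMap A₀ A₁} (hN : IsChannel N) (n : ℕ) :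
    IsChannel (tensorPower N n) := by
  obtain ⟨h1, h2⟩ := isChannel_iff.1 hN
  refine isChannel_iff.2 ⟨choi_tensorPower N n ▸ pairPower_posSemidef h1 n, fun p q => ?_⟩
  simp only [choi_tensorPower, pairPower_apply]
  rw [← Fintype.prod_sum (f := fun i y => choi N (p i, y) (q i, y))]
  simp only [h2]
  split_ifs with h
  · simp [h]
  · obtain ⟨i, hi⟩ := Function.ne_iff.1 h
    exact Finset.prod_eq_zero (Finset.mem_univ i) (if_neg hi)

end Power

end DynCoherence

/-! ### Superchannels, measure-and-prepare maps and the one-shot cost -/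

namespace DynCoherence

open Matrix

section Superchannel

variable {A₀ A₁ B₀ B₁ : Type*} [Fintype A₀] [Fintype A₁] [Fintype B₀] [Fintype B₁]
  [DecidableEq A₀] [DecidableEq A₁] [DecidableEq B₀] [DecidableEq B₁]

omit [Fintype A₀] [Fintype A₁] [DecidableEq A₁] in
lemma choi_ampliation_fin_one (Φ : LMap A₀ A₁) :
    choi (ampliation (Fin 1) Φ) =
      (choi Φ).submatrix (fun p => (p.1.2, p.2.2)) fun p => (p.1.2, p.2.2) := by
  ext ⟨⟨r, i⟩, k, a⟩ ⟨⟨s, j⟩, l, b⟩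
  simp only [choi_apply, submatrix_apply, ampliation, LinearMap.coe_mk, AddHom.coe_mk, of_apply]
  refine congrFun (congrFun (congrArg Φ (Matrix.ext fun x y => ?_)) a) b
  rw [block_apply]
  simp [single_apply, Subsingleton.elim r k, Subsingleton.elim s l]

omit [DecidableEq A₁] in
lemma isChannel_ampliation_fin_one {Φ : LMap A₀ A₁} :
    IsChannel (ampliation (Fin 1) Φ) ↔ IsChannel Φ := by
  rw [isChannel_iff, isChannel_iff, choi_ampliation_fin_one]
  constructor
  · rintro ⟨h1, h2⟩
    refine ⟨h1.submatrix fun p : A₀ × A₁ => (((0 : Fin 1), p.1), ((0 : Fin 1), p.2)), fun i j => ?_⟩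
    have := h2 (0, i) (0, j)
    simpa [Fintype.sum_prod_type] using this
  · rintro ⟨h1, h2⟩
    refine ⟨h1.submatrix _, fun i j => ?_⟩
    simp only [submatrix_apply, Fintype.sum_prod_type, Finset.univ_unique, Finset.sum_singleton, h2,
      Prod.ext_iff, Subsingleton.elim i.1 j.1, true_and]

omit [Fintype A₀] [Fintype A₁] [Fintype B₀] [Fintype B₁] [DecidableEq A₀] [DecidableEq A₁]
  [DecidableEq B₀] [DecidableEq B₁] in
lemma idTensor_ampliation_fin_one (Θ : LMap A₀ A₁ →ₗ[ℂ] LMap B₀ B₁) (Φ : LMap A₀ A₁) :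
    idTensor Θ (ampliation (Fin 1) Φ) = ampliation (Fin 1) (Θ Φ) := by
  have h : ∀ i j k l : Fin 1, component i j k l (ampliation (Fin 1) Φ) = Φ := by
    intro i j k l
    ext X a b
    simp only [component, ampliation, LinearMap.coe_mk, AddHom.coe_mk, block_apply, of_apply]
    refine congrFun (congrFun (congrArg Φ (Matrix.ext fun x y => ?_)) a) b
    rw [block_apply]
    simp [kronecker, Subsingleton.elim i k, Subsingleton.elim j l]
  ext X p q
  simp only [idTensor, ampliation, LinearMap.coe_mk, AddHom.coe_mk, of_apply] at h ⊢
  simp only [h, Finset.univ_unique, Finset.sum_singleton, Subsingleton.elim p.1 default,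
    Subsingleton.elim q.1 default]

omit [DecidableEq A₁] [DecidableEq B₁] in
-- A one-dimensional reference system changes nothing.
lemma IsSuperchannel.isChannel {Θ : LMap A₀ A₁ →ₗ[ℂ] LMap B₀ B₁} (hΘ : IsSuperchannel Θ)
    {Φ : LMap A₀ A₁} (hΦ : IsChannel Φ) : IsChannel (Θ Φ) := by
  have h := hΘ 1 1 _ (isChannel_ampliation_fin_one.2 hΦ)
  rwa [idTensor_ampliation_fin_one, isChannel_ampliation_fin_one] at h

omit [Fintype A₁] [DecidableEq A₁] in
@[simp] lemma choi_preparation_apply (ρ : Matrix A₁ A₁ ℂ) (p q : Unit × A₁) :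
    choi (preparation ρ) p q = ρ p.2 q.2 := by
  simp [preparation]

omit [DecidableEq A₁] in
lemma isChannel_preparation {ρ : Matrix A₁ A₁ ℂ} (hρ : ρ.PosSemidef) (h1 : ρ.trace = 1) :
    IsChannel (preparation ρ) := by
  refine isChannel_iff.2 ⟨?_, fun i j => ?_⟩
  · convert hρ.submatrix (Prod.snd : Unit × A₁ → A₁) using 1
    ext p q
    rw [choi_preparation_apply, submatrix_apply]
  · simp only [choi_preparation_apply]
    simpa [trace] using h1

omit [Fintype A₁] [DecidableEq A₁] in
lemma preparation_smul (c : ℂ) (ρ : Matrix A₁ A₁ ℂ) :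
    preparation (c • ρ) = c • preparation ρ := by
  ext X a b
  simp [preparation, mul_left_comm]

omit [Fintype A₁] [DecidableEq A₁] in
lemma preparation_sub (ρ σ : Matrix A₁ A₁ ℂ) :
    preparation (ρ - σ) = preparation ρ - preparation σ := by
  ext X a b
  simp [preparation, mul_sub]

omit [DecidableEq A₁] [DecidableEq B₁] in
-- Superchannels are only known to act well on normalized states; rescaling by the trace extends
-- positivity to operators such as `1 - plusState m`.
lemma IsSuperchannel.choi_preparation_posSemidef {Θ : LMap Unit A₁ →ₗ[ℂ] LMap B₀ B₁}
    (hΘ : IsSuperchannel Θ) {ρ : Matrix A₁ A₁ ℂ} (hρ : ρ.PosSemidef) :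
    (choi (Θ (preparation ρ))).PosSemidef := by
  by_cases h0 : ρ.trace = 0
  · have e : preparation ρ = 0 := by
      rw [(hρ.trace_eq_zero_iff).1 h0]
      ext X a b
      simp [preparation]
    rw [e, map_zero]
    exact PosSemidef.zero
  · have h1 : 0 ≤ ρ.trace⁻¹ := by
      rw [← ofReal_re_of_nonneg hρ.trace_nonneg, ← Complex.ofReal_inv, Complex.zero_le_real]
      exact inv_nonneg.2 (Complex.nonneg_iff.1 hρ.trace_nonneg).1
    have h2 := hΘ.isChannel (isChannel_preparation (hρ.smul h1)
      (by rw [trace_smul, smul_eq_mul, inv_mul_cancel₀ h0]))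
    have h3 : Θ (preparation ρ) = ρ.trace • Θ (preparation (ρ.trace⁻¹ • ρ)) := by
      rw [← map_smul, ← preparation_smul, smul_inv_smul₀ h0]
    rw [h3, choi_smul]
    exact h2.cp.choi_posSemidef.smul hρ.trace_nonneg

end Superchannel

section PlusState

variable {m : ℕ}

lemma plusState_isHermitian : (plusState m).IsHermitian := by
  ext i j
  simp [plusState]

lemma plusState_mul_self (hm : 0 < m) : plusState m * plusState m = plusState m := by
  ext i j
  have : (m : ℂ) ≠ 0 := by exact_mod_cast hm.ne'
  simp [plusState, mul_apply, this]

lemma trace_plusState (hm : 0 < m) : (plusState m).trace = 1 := by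
  have : (m : ℂ) ≠ 0 := by exact_mod_cast hm.ne'
  simp [plusState, trace, this]

lemma plusState_posSemidef (hm : 0 < m) : (plusState m).PosSemidef := by
  have h := posSemidef_conjTranspose_mul_self (plusState m)
  rwa [plusState_isHermitian, plusState_mul_self hm] at h

lemma one_sub_plusState_posSemidef (hm : 0 < m) :
    (1 - plusState m).PosSemidef := by
  have h := posSemidef_conjTranspose_mul_self (1 - plusState m)
  have e : (1 - plusState m)ᴴ * (1 - plusState m) = 1 - plusState m := by
    rw [conjTranspose_sub, plusState_isHermitian, conjTranspose_one, sub_mul, mul_sub, mul_sub,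
      plusState_mul_self hm]
    simp
  rwa [e] at h

end PlusState

section Cost

variable {A₀ A₁ : Type*} [Fintype A₀] [Fintype A₁] [DecidableEq A₀] [DecidableEq A₁]

/-- The identity is `m` times the maximally mixed state, which is classical, so its image is `m`
times a classical channel. Positivity on `1 - plusState m` says that this dominates the image of
`plusState m`. -/
lemma IsMISC.mem_feasible {m : ℕ} (hm : 0 < m) {Θ : LMap Unit (Fin m) →ₗ[ℂ] LMap A₀ A₁}
    (hΘ : IsMISC Θ) : (m : ℝ) ∈ feasible (choi (Θ (preparation (plusState m)))) := by
  have hm' : (m : ℝ) ≠ 0 := by exact_mod_cast hm.ne'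
  have hcl : IsClassical (preparation ((m : ℂ)⁻¹ • (1 : Matrix (Fin m) (Fin m) ℂ))) := by
    have h := isClassical_classicalMap (A₀ := Unit) (A₁ := Fin m) (d := fun _ => (m : ℝ)⁻¹)
      ⟨fun _ => by positivity, fun x => by simp [hm']⟩
    convert h using 1
    refine lmap_ext_choi ?_
    rw [choi_classicalMap]
    ext p q
    rw [choi_preparation_apply, show diagR _ p q = _ from diagonal_apply .., Matrix.smul_apply,
      one_apply]
    simp [Prod.ext_iff]
  obtain ⟨d, hd, he⟩ := (hΘ.map_classical _ hcl).exists_eq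
  refine ⟨d, hd, ?_⟩
  have h := hΘ.superchannel.choi_preparation_posSemidef (one_sub_plusState_posSemidef hm)
  rw [preparation_sub, map_sub, choi_sub] at h
  rw [preparation_smul, map_smul] at he
  rw [← choi_classicalMap, ← he, choi_smul, smul_smul]
  have hm'' : ((m : ℝ) : ℂ) * (m : ℂ)⁻¹ = 1 := by
    rw [Complex.ofReal_natCast]
    exact mul_inv_cancel₀ (by exact_mod_cast hm.ne')
  rwa [hm'', one_smul]

/-- The linear functional `Φ ↦ tr (P Φ(1))` on maps with trivial input. -/
def outcome {α : Type*} [Fintype α] (P : Matrix α α ℂ) : LMap Unit α →ₗ[ℂ] ℂ :=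
  traceLinearMap α ℂ ℂ ∘ₗ LinearMap.mulLeft ℂ P ∘ₗ LinearMap.applyₗ (1 : Matrix Unit Unit ℂ)

lemma outcome_apply {α : Type*} [Fintype α] (P : Matrix α α ℂ) (Φ : LMap Unit α) :
    outcome P Φ = (P * Φ 1).trace := rfl

/-- The supermap that measures the effect `P` and outputs `N` or `F` according to the outcome. -/
def measurePrepare {m : ℕ} (P : Matrix (Fin m) (Fin m) ℂ) (N F : LMap A₀ A₁) :
    LMap Unit (Fin m) →ₗ[ℂ] LMap A₀ A₁ :=
  (outcome P).smulRight N + (outcome (1 - P)).smulRight F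

omit [Fintype A₀] [Fintype A₁] [DecidableEq A₀] [DecidableEq A₁] in
lemma measurePrepare_apply {m : ℕ} (P : Matrix (Fin m) (Fin m) ℂ) (N F : LMap A₀ A₁)
    (Φ : LMap Unit (Fin m)) :
    measurePrepare P N F Φ = outcome P Φ • N + outcome (1 - P) Φ • F := rfl

omit [Fintype A₀] [Fintype A₁] [DecidableEq A₀] [DecidableEq A₁] in
lemma choi_idTensor {R₀ R₁ B₀ B₁ : Type*} [Fintype R₀] [DecidableEq R₀] [DecidableEq B₀]
    (Θ : LMap A₀ A₁ →ₗ[ℂ] LMap B₀ B₁) (M : LMap (R₀ × A₀) (R₁ × A₁))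
    (p q : (R₀ × B₀) × R₁ × B₁) :
    choi (idTensor Θ M) p q =
      choi (Θ (component p.1.1 q.1.1 p.2.1 q.2.1 M)) (p.1.2, p.2.2) (q.1.2, q.2.2) := by
  obtain ⟨⟨i, x⟩, k, a⟩ := p
  obtain ⟨⟨j, y⟩, l, b⟩ := q
  have h : ∀ i' j', block i' j' (single (i, x) (j, y) (1 : ℂ)) =
      if i = i' ∧ j = j' then single x y 1 else 0 := by
    intro i' j'
    ext u v
    rw [block_apply]
    split_ifs with h
    · simp [single_apply, h.1, h.2]
    · simp only [single_apply, Prod.mk.injEq, Matrix.zero_apply]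
      rw [if_neg]
      tauto
  simp only [choi_apply, idTensor, LinearMap.coe_mk, AddHom.coe_mk, of_apply, h]
  rw [Finset.sum_eq_single i, Finset.sum_eq_single j]
  · simp
  · intro j' _ hj
    simp [hj.symm]
  · simp
  · intro i' _ hi
    simp [hi.symm]
  · simp

lemma outcome_component {m : ℕ} {R₀ R₁ : Type*} [DecidableEq R₀] (P : Matrix (Fin m) (Fin m) ℂ)
    (i j : R₀) (k l : R₁) (M : LMap (R₀ × Unit) (R₁ × Fin m)) :
    outcome P (component i j k l M) =
      ∑ u, ∑ v, Pᵀ u v * choi M ((i, ()), (k, u)) ((j, ()), (l, v)) := by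
  have h : kronecker (single i j (1 : ℂ)) (1 : Matrix Unit Unit ℂ) = single (i, ()) (j, ()) 1 := by
    ext ⟨a, b⟩ ⟨c, d⟩
    simp [kronecker, single_apply]
  rw [outcome_apply, trace, Finset.sum_comm]
  refine Finset.sum_congr rfl fun u _ => ?_
  rw [diag_apply, mul_apply]
  refine Finset.sum_congr rfl fun v _ => ?_
  rw [choi_apply, ← h]
  rfl

omit [DecidableEq A₁] in
-- With a reference attached, the Choi matrix is a sum of two Kronecker products: an unnormalized
-- map left on the reference by each outcome, times the channel prepared. Since the effects sum to
-- `1`, trace preservation reduces to that of `M`.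
lemma isSuperchannel_measurePrepare {m : ℕ} {P : Matrix (Fin m) (Fin m) ℂ} (hP : P.PosSemidef)
    (hQ : (1 - P).PosSemidef) {N F : LMap A₀ A₁} (hN : IsChannel N) (hF : IsChannel F) :
    IsSuperchannel (measurePrepare P N F) := by
  intro r₀ r₁ M hM
  rw [isChannel_iff] at hM hN hF ⊢
  have key : ∀ Q : Matrix (Fin m) (Fin m) ℂ, Q.PosSemidef →
      (Matrix.of fun p q : Fin r₀ × Fin r₁ =>
        outcome Q (component p.1 q.1 p.2 q.2 M)).PosSemidef := by
    intro Q hQ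
    convert posSemidef_contract (hQ.transpose.kronecker hM.1)
      (fun (u : Fin m) (p : Fin r₀ × Fin r₁) => (u, ((p.1, ()), (p.2, u)))) using 1
    ext p q
    simp only [of_apply, outcome_component, kroneckerMap_apply]
  have hchoi : ∀ p q, choi (idTensor (measurePrepare P N F) M) p q =
      outcome P (component p.1.1 q.1.1 p.2.1 q.2.1 M) * choi N (p.1.2, p.2.2) (q.1.2, q.2.2) +
      outcome (1 - P) (component p.1.1 q.1.1 p.2.1 q.2.1 M) *
        choi F (p.1.2, p.2.2) (q.1.2, q.2.2) := by
    intro p q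
    rw [choi_idTensor, measurePrepare_apply, choi_add, choi_smul, choi_smul]
    rfl
  constructor
  · have h := (((key P hP).kronecker hN.1).add ((key _ hQ).kronecker hF.1)).submatrix
      fun p : (Fin r₀ × A₀) × Fin r₁ × A₁ => ((p.1.1, p.2.1), (p.1.2, p.2.2))
    exact (Matrix.ext hchoi : choi (idTensor (measurePrepare P N F) M) = _) ▸ h
  · intro i j
    simp only [hchoi, Fintype.sum_prod_type, Finset.sum_add_distrib, ← Finset.mul_sum, hN.2, hF.2]
    rw [← Finset.sum_add_distrib]
    simp only [← add_mul]
    have hsum : ∀ Φ : LMap Unit (Fin m), outcome P Φ + outcome (1 - P) Φ = outcome 1 Φ := by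
      intro Φ
      simp [outcome_apply, sub_mul]
    have h1 := hM.2 (i.1, ()) (j.1, ())
    rw [Fintype.sum_prod_type] at h1
    simp only [hsum]
    simp only [outcome_component, transpose_one, one_apply, ite_mul, one_mul, zero_mul,
      Finset.sum_ite_eq, Finset.mem_univ, if_true, ← Finset.sum_mul, h1]
    simp only [Prod.ext_iff, and_true]
    split_ifs <;> simp_all

lemma exists_isMISC {N : LMap A₀ A₁} (hN : IsChannel N) {m : ℕ} (hm : 1 < m)
    (h : (m : ℝ) ∈ feasible (choi N)) :
    ∃ Θ : LMap Unit (Fin m) →ₗ[ℂ] LMap A₀ A₁,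
      IsMISC Θ ∧ Θ (preparation (plusState m)) = N := by
  obtain ⟨d, hd, hp⟩ := h
  have hm0 : 0 < m := by omega
  have hmC : (m : ℂ) ≠ 0 := by exact_mod_cast hm0.ne'
  have hmC1 : (m : ℂ) - 1 ≠ 0 := by
    rw [sub_ne_zero]
    exact_mod_cast hm.ne'
  -- Chosen so that `N + (m - 1) F = m E` for the dominating classical channel `E`; the division
  -- requires `m > 1`.
  let F : LMap A₀ A₁ := ((m : ℂ) - 1)⁻¹ • ((m : ℂ) • classicalMap d - N)
  have hF : IsChannel F := by
    have h1 := isChannel_iff.1 hN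
    have h2 := isChannel_iff.1 (isClassical_classicalMap hd).channel
    have h3 : (0 : ℂ) ≤ ((m : ℂ) - 1)⁻¹ := by
      have : (0 : ℝ) ≤ ((m : ℝ) - 1)⁻¹ := by
        rw [inv_nonneg, sub_nonneg]
        exact_mod_cast hm.le
      simpa using Complex.zero_le_real.2 this
    refine isChannel_iff.2 ⟨?_, fun i j => ?_⟩
    · rw [choi_smul, choi_sub, choi_smul, choi_classicalMap]
      exact PosSemidef.smul (by exact_mod_cast hp) h3
    · simp only [F, choi_smul, choi_sub, Matrix.smul_apply, Matrix.sub_apply, smul_eq_mul,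
        ← Finset.mul_sum, Finset.sum_sub_distrib, h1.2, h2.2]
      split_ifs
      · field_simp
      · simp
  refine ⟨measurePrepare (plusState m) N F, ⟨isSuperchannel_measurePrepare
    (plusState_posSemidef hm0) (one_sub_plusState_posSemidef hm0) hN hF, fun E hE => ?_⟩, ?_⟩
  · obtain ⟨e, he, rfl⟩ := hE.exists_eq
    have h1 : (classicalMap e 1 : Matrix (Fin m) (Fin m) ℂ) =
        diagonal fun y => (e ((), y) : ℂ) := by
      simp [classicalMap]
    have hsum : ∑ y, (e ((), y) : ℂ) = 1 := by exact_mod_cast he.2 ()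
    -- Every diagonal state passes the coherent test with probability exactly `1/m`, so all
    -- classical inputs yield the same mixture, namely `classicalMap d`.
    have h2 : outcome (plusState m) (classicalMap e) = (m : ℂ)⁻¹ := by
      rw [outcome_apply, h1]
      simp [trace, mul_diagonal, plusState, ← Finset.mul_sum, hsum]
    have h3 : outcome (1 - plusState m) (classicalMap e) = 1 - (m : ℂ)⁻¹ := by
      rw [← h2, outcome_apply, outcome_apply, sub_mul, trace_sub, one_mul, h1, trace_diagonal, hsum]
    have h4 : measurePrepare (plusState m) N F (classicalMap e) = classicalMap d := by
      rw [measurePrepare_apply, h2, h3]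
      simp only [F, smul_sub, smul_smul]
      have h5 : (1 - (m : ℂ)⁻¹) * ((m : ℂ) - 1)⁻¹ = (m : ℂ)⁻¹ := by field_simp
      rw [h5, ← mul_assoc, h5, inv_mul_cancel₀ hmC, one_smul]
      abel
    rw [h4]
    exact isClassical_classicalMap hd
  · have h1 : (preparation (plusState m)) 1 = plusState m := by simp [preparation]
    rw [measurePrepare_apply, outcome_apply, outcome_apply, h1, sub_mul, one_mul,
      plusState_mul_self hm0, trace_plusState hm0]
    simp

end Cost

end DynCoherence

/-! ### Attainment of the minima and the asymptotic limit -/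

namespace DynCoherence

open Matrix Filter Topology

section Main

variable {A₀ A₁ : Type*} [Fintype A₀] [Fintype A₁] [DecidableEq A₀] [DecidableEq A₁]

omit [Fintype A₀] in
lemma mem_feasible_of_le {J : Matrix (A₀ × A₁) (A₀ × A₁) ℂ} {s t : ℝ} (hs : s ∈ feasible J)
    (hst : s ≤ t) : t ∈ feasible J := by
  obtain ⟨d, hd, h⟩ := hs
  refine ⟨d, hd, ?_⟩
  have h' := h.add (posSemidef_smul_ofReal (diagR_posSemidef hd.1) (sub_nonneg.2 hst))
  convert h' using 1
  rw [Complex.ofReal_sub, sub_smul]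
  abel

lemma pow_mem_feasible_pairPower {J : Matrix (A₀ × A₁) (A₀ × A₁) ℂ} (hJ : J.PosSemidef) {l : ℝ}
    (hl : l ∈ feasible J) (n : ℕ) : l ^ n ∈ feasible (pairPower J n) := by
  obtain ⟨d, hd, h⟩ := hl
  refine ⟨_, stochasticPower_mem hd n, ?_⟩
  have h' := pairPower_sub_posSemidef hJ h n
  rwa [pairPower_smul, pairPower_diagR, ← Complex.ofReal_pow] at h'

lemma isLeast_Dmax_image {N : LMap A₀ A₁} {l : ℝ} (hl0 : 0 < l)
    (hl : IsLeast (feasible (choi N)) l) :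
    IsLeast (Dmax N '' {E | IsClassical E}) ((Real.logb 2 l : ℝ) : EReal) := by
  have hlow : ∀ E, IsClassical E → ((Real.logb 2 l : ℝ) : EReal) ≤ Dmax N E := by
    intro E hE
    obtain ⟨d, hd, rfl⟩ := hE.exists_eq
    refine le_sInf ?_
    rintro _ ⟨t, ht, hcp, rfl⟩
    rw [isCP_iff_choi, choi_smul_classicalMap_sub] at hcp
    exact EReal.coe_le_coe_iff.2 (Real.logb_le_logb_of_le one_lt_two hl0 (hl.2 ⟨d, hd, hcp⟩))
  refine ⟨?_, ?_⟩
  · obtain ⟨d, hd, hp⟩ := hl.1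
    refine ⟨classicalMap d, isClassical_classicalMap hd, le_antisymm (sInf_le ⟨l, hl0, ?_, rfl⟩)
      (hlow _ (isClassical_classicalMap hd))⟩
    rwa [isCP_iff_choi, choi_smul_classicalMap_sub]
  · rintro _ ⟨E, hE, rfl⟩
    exact hlow E hE

/-- The costs are logarithms of positive integers, so well-ordering provides a minimum. -/
lemma exists_isLeast_costSet {N : LMap A₀ A₁} (h : (costSet N).Nonempty) :
    ∃ m : ℕ, IsLeast (costSet N) ((Real.logb 2 m : ℝ) : EReal) := by
  classical
  have hex : ∃ m : ℕ, 0 < m ∧ ∃ Θ : LMap Unit (Fin m) →ₗ[ℂ] LMap A₀ A₁,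
      IsMISC Θ ∧ Θ (preparation (plusState m)) = N := by
    obtain ⟨c, m, hm, -, hΘ⟩ := h
    exact ⟨m, hm, hΘ⟩
  obtain ⟨hm, hΘ⟩ := Nat.find_spec hex
  refine ⟨Nat.find hex, ⟨_, hm, rfl, hΘ⟩, ?_⟩
  rintro _ ⟨k, hk, rfl, hΘk⟩
  refine EReal.coe_le_coe_iff.2 (Real.logb_le_logb_of_le one_lt_two (by exact_mod_cast hm) ?_)
  exact_mod_cast Nat.find_min' hex ⟨hk, hΘk⟩

/-- The one-shot cost of a tensor power is attained and equals the log-robustness of a single copy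
times the number of copies, up to a bounded error. -/
lemma exists_isLeast_costSet_tensorPower [Nonempty A₁] {N : LMap A₀ A₁} (hN : IsChannel N) {l : ℝ}
    (hl1 : 1 ≤ l) (hl : IsLeast (feasible (choi N)) l) (n : ℕ) :
    ∃ c : ℝ, IsLeast (costSet (tensorPower N n)) (c : EReal) ∧ n * Real.logb 2 l ≤ c ∧
      c ≤ Real.logb 2 3 + n * Real.logb 2 l := by
  have hl0 : 0 < l := by linarith
  have hJ := hN.cp.choi_posSemidef
  have hln : 1 ≤ l ^ n := one_le_pow₀ hl1
  -- The extra `+ 1` ensures `m > 1` even when `l ^ n = 1`. Since `l ^ n ≥ 1`, this `m` is below `l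
  -- ^ n + 2 ≤ 3 * l ^ n`, whence the constant `logb 2 3`.
  obtain ⟨Θ, hΘ⟩ := exists_isMISC (isChannel_tensorPower hN n) (m := ⌈l ^ n⌉₊ + 1)
    (by have := Nat.ceil_pos.2 (zero_lt_one.trans_le hln); omega)
    (by
      rw [choi_tensorPower]
      refine mem_feasible_of_le (pow_mem_feasible_pairPower hJ hl.1 n) ?_
      push_cast
      linarith [Nat.le_ceil (l ^ n)])
  have hmem : ((Real.logb 2 (⌈l ^ n⌉₊ + 1 : ℕ) : ℝ) : EReal) ∈ costSet (tensorPower N n) :=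
    ⟨_, Nat.succ_pos _, rfl, Θ, hΘ⟩
  obtain ⟨m, hleast⟩ := exists_isLeast_costSet ⟨_, hmem⟩
  refine ⟨_, hleast, ?_, ?_⟩
  · obtain ⟨k, hk, hke, Θ', hΘ', he⟩ := hleast.1
    rw [EReal.coe_eq_coe_iff.1 hke, ← Real.logb_pow]
    refine Real.logb_le_logb_of_le one_lt_two (by positivity) ?_
    have hf := hΘ'.mem_feasible hk
    rw [he, choi_tensorPower] at hf
    exact pow_le_of_isLeast_feasible hJ hl0 hl (by exact_mod_cast hk) hf
  · refine (EReal.coe_le_coe_iff.1 (hleast.2 hmem)).trans ?_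
    rw [← Real.logb_pow, ← Real.logb_mul (by norm_num) (by positivity)]
    refine Real.logb_le_logb_of_le one_lt_two (by positivity) ?_
    push_cast
    linarith [(Nat.ceil_lt_add_one (by positivity : 0 ≤ l ^ n))]

end Main

end DynCoherence

open DynCoherence in
theorem mainTheorem1 {A₀ A₁ : Type*} [Fintype A₀] [Fintype A₁] [DecidableEq A₀] [DecidableEq A₁]
    [Nonempty A₀] (N : DynCoherence.LMap A₀ A₁) (hN : DynCoherence.IsChannel N) :
    -- the minimum in the definition of the log-robustness exists and is finite
    IsLeast (DynCoherence.Dmax N '' {E | DynCoherence.IsClassical E})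
        (DynCoherence.logRobustness N) ∧
      (∃ L : ℝ, DynCoherence.logRobustness N = (L : EReal)) ∧
      -- the minimum in the definition of the one-shot cost exists for all tensor powers
      (∀ n : ℕ, IsLeast (DynCoherence.costSet (DynCoherence.tensorPower N n))
        (DynCoherence.oneShotCost (DynCoherence.tensorPower N n))) ∧
      -- the exact asymptotic cost exists and equals the log-robustness
      Filter.Tendsto
        (fun n : ℕ => DynCoherence.oneShotCost (DynCoherence.tensorPower N n) / (n : EReal))
        Filter.atTop (nhds (DynCoherence.logRobustness N)) := by
  obtain ⟨hJ, hJ1⟩ := isChannel_iff.1 hN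
  have hJ1' : ∀ i, ∑ a, choi N (i, a) (i, a) = 1 := fun i => by rw [hJ1, if_pos rfl]
  have := nonempty_of_sum_eq_one hJ1'
  obtain ⟨l, hl⟩ := exists_isLeast_feasible hJ.1 hJ1'
  have hl1 := one_le_of_mem_feasible hJ1' hl.1
  have hLR := isLeast_Dmax_image (by linarith) hl
  have hLR' : logRobustness N = ((Real.logb 2 l : ℝ) : EReal) := hLR.isGLB.sInf_eq
  choose c hc hlow hup using exists_isLeast_costSet_tensorPower hN hl1 hl
  have hcost : ∀ n, oneShotCost (tensorPower N n) = (c n : EReal) := fun n =>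
    (hc n).isGLB.sInf_eq
  refine ⟨hLR' ▸ hLR, ⟨_, hLR'⟩, fun n => hcost n ▸ hc n, ?_⟩
  -- Squeeze between `logb 2 l` and `logb 2 l + logb 2 3 / n`, for `n > 0`.
  have hlim : Filter.Tendsto (fun n : ℕ => c n / n) Filter.atTop (nhds (Real.logb 2 l)) := by
    have h1 : Filter.Tendsto (fun n : ℕ => Real.logb 2 3 / n + Real.logb 2 l) Filter.atTop
        (nhds (0 + Real.logb 2 l)) :=
      (tendsto_const_div_atTop_nhds_zero_nat _).add tendsto_const_nhds
    rw [zero_add] at h1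
    refine tendsto_of_tendsto_of_tendsto_of_le_of_le' tendsto_const_nhds h1 ?_ ?_
    · filter_upwards [Filter.eventually_gt_atTop 0] with n hn
      rw [le_div_iff₀ (by exact_mod_cast hn), mul_comm]
      exact hlow n
    · filter_upwards [Filter.eventually_gt_atTop 0] with n hn
      have hn' : (0 : ℝ) < n := by exact_mod_cast hn
      rw [div_add' _ _ _ hn'.ne', div_le_div_iff_of_pos_right hn', mul_comm (Real.logb 2 l)]
      exact hup n
  rw [hLR']
  have h := (continuous_coe_real_ereal.tendsto _).comp hlim
  refine h.congr fun n => ?_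
  simp only [Function.comp_apply, hcost, EReal.coe_div]
  rfl
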